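/- Let $V$ be a finite set of qubits. A \emph{stabilizer-state graph} on $V$ is a simple graph on $V$ in which each node is either solid or hollow, may or may not carry a self loop, and may or may not carry a minus sign. (A looped node is not its own neighbor; nodes are labeled by the qubits.) It represents the quantum state (vectors being taken up to a global phase) obtained from $|0\rangle^{\otimes V}$ by applying the Hadamard gate $H=\tfrac{1}{\sqrt2}\begin{pmatrix}1&1\\1&-1\end{pmatrix}$ to every qubit, then a controlled-$Z$ gate for every edge, and then on each qubit, in this order, $Z$ if the node has a minus sign, $S=\mathrm{diag}(1,i)$ if it has a loop, and $H$ if it is hollow. Two graphs are \emph{equivalent} if they represent the same state. A graph is \emph{reduced} if no hollow node has a loop and no two hollow nodes are connected. \emph{Local complementation on a node} complements all edges between its neighbors; \emph{local complementation along an edge} $ab$ is local complementation on $a$, then $b$, then $a$. To \emph{advance} the loop of a node means to add a loop if there is none, and otherwise to remove the loop and flip the node's sign. Consider the following rules. E1. For a node with a loop: flip its fill, perform local complementation on it, advance the loops of its neighbors, and flip its sign; if it now has a minus sign, flip the signs of its neighbors. E2. For two connected nodes without loops: flip both fills, local complement along the edge between them, and flip the signs of the nodes that were connected to both; for each of the two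 nodes that had a minus sign in the original graph, flip its sign and the signs of its current neighbors. E(i). In a reduced graph, for a hollow node $h$ connected to a solid node $s$ with a loop: local complement on $s$ and then on $h$, remove the loop from $s$, advance the loops of the current neighbors of $s$, and flip the fills of $h$ and $s$. Flip the signs of the nodes that were originally connected to both $s$ and $h$; if $s$ initially had a minus sign, flip its sign and the signs of its current neighbors; if $h$ initially had a minus sign, flip the signs of its current neighbors. E(ii). In a reduced graph, for a hollow node connected to a solid node without a loop: local complement along the edge between them and flip both fills, with signs changed as in E2. Then: (1) E1 and E2 take any stabilizer-state graph to an equivalent one. (2) E(i) and E(ii) take any reduced graph to an equivalent reduced graph. (3) Two stabilizer-state graphs on $V$ are equivalent if and only if the first can be converted into the second by a finite sequence of applications of E1 and E2. (4) Two reduced graphs on $V$ are equivalent if and only if the first can be converted into the second by a finite sequence of applications of E(i) and E(ii). (5) A stabilizer-state graph is reduced if and only if no graph equivalent to it has fewer hollow nodes. -/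

import Mathlib

open Matrix
open scoped symmDiff

/-- A stabilizer-state graph with node (qubit) set `V`: a simple graph of edges, together with
the set of hollow nodes (all other nodes are solid), the set of nodes carrying a self loop, and
the set of nodes carrying a minus sign. -/
@[ext]
structure StabGraph (V : Type*) where
  edges : SimpleGraph V
  hollow : Set V
  loops : Set V
  minus : Set V

namespace StabGraph

variable {V : Type*}

/-! ### The state represented by a stabilizer graph -/

section State

/-- The Hadamard gate. -/
noncomputable def gateH : Matrix (Fin 2) (Fin 2) ℂ :=
  ((1 / Real.sqrt 2 : ℝ) : ℂ) • !![1, 1; 1, -1]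

/-- The phase gate. -/
def gateS : Matrix (Fin 2) (Fin 2) ℂ := !![1, 0; 0, Complex.I]

/-- The Pauli `Z` gate. -/
def gateZ : Matrix (Fin 2) (Fin 2) ℂ := !![1, 0; 0, -1]

variable [Fintype V]

/-- The operator `⨂_v U_v` on the qubits `V`, as a matrix in the standard basis, whose elements
are indexed by the bit strings `V → Fin 2`. -/
def tensorGate (U : V → Matrix (Fin 2) (Fin 2) ℂ) : Matrix (V → Fin 2) (V → Fin 2) ℂ :=
  Matrix.of fun x y => ∏ v, U v (x v) (y v)

variable [DecidableEq V]

/-- The standard basis state `|0…0⟩`. -/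
def ketZero : (V → Fin 2) → ℂ := Pi.single 0 1

open scoped Classical in
/-- The product of the (diagonal, hence commuting) controlled-`Z` gates over all edges: the
gate of the edge `e` multiplies `|x⟩` by `-1` when both end points of `e` have bit `1`. -/
noncomputable def czLayer (Γ : SimpleGraph V) : Matrix (V → Fin 2) (V → Fin 2) ℂ :=
  Matrix.diagonal fun x =>
    ∏ e : Sym2 V, if e ∈ Γ.edgeSet ∧ ∀ v ∈ e, x v = 1 then (-1 : ℂ) else 1

open scoped Classical in
/-- The terminal gates on qubit `v`: first `Z` if the node has a minus sign, then `S` if it has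
a loop, then `H` if it is hollow. -/
noncomputable def terminalGate (G : StabGraph V) (v : V) : Matrix (Fin 2) (Fin 2) ℂ :=
  (if v ∈ G.hollow then gateH else 1) * (if v ∈ G.loops then gateS else 1) *
    (if v ∈ G.minus then gateZ else 1)

/-- The output of the graph-form circuit of `G`: `H` on every qubit of `|0…0⟩`, then a
controlled-`Z` for each edge, then the terminal gates. -/
noncomputable def state (G : StabGraph V) : (V → Fin 2) → ℂ :=
  tensorGate G.terminalGate *ᵥ (czLayer G.edges *ᵥ (tensorGate (fun _ => gateH) *ᵥ ketZero))

/-- Two graphs are equivalent when they represent the same quantum state, that is, when their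
state vectors agree up to a global phase. -/
def Equivalent (G G' : StabGraph V) : Prop :=
  ∃ c : ℂ, ‖c‖ = 1 ∧ G'.state = c • G.state

end State

/-! ### Elementary operations on stabilizer graphs -/

/-- The neighbors of a node; a node is never its own neighbor, even if it has a loop. -/
def nbr (G : StabGraph V) (v : V) : Set V := G.edges.neighborSet v

/-- Flip the fills of the nodes in `A`. -/
def flipFill (G : StabGraph V) (A : Set V) : StabGraph V :=
  { G with hollow := G.hollow ∆ A }

/-- Flip the signs of the nodes in `A`. -/
def flipSign (G : StabGraph V) (A : Set V) : StabGraph V :=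
  { G with minus := G.minus ∆ A }

/-- Advance the loops of the nodes in `A`: a node of `A` without a loop acquires one; a node of
`A` with a loop loses it and has its sign flipped. -/
def advance (G : StabGraph V) (A : Set V) : StabGraph V :=
  { G with loops := G.loops ∆ A, minus := G.minus ∆ (G.loops ∩ A) }

/-- Remove the loop, if any, of the node `v`. -/
def removeLoop (G : StabGraph V) (v : V) : StabGraph V :=
  { G with loops := G.loops \ {v} }

/-- Local complementation on the node `v`: complement the edges between all neighbors of `v`. -/
def localComp (G : StabGraph V) (v : V) : StabGraph V :=
  { G with
    edges :=
      { Adj := fun x y => x ≠ y ∧ Xor (G.edges.Adj x y) (G.edges.Adj v x ∧ G.edges.Adj v y)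
        symm := ⟨fun x y h =>
          ⟨h.1.symm, by simpa only [G.edges.adj_comm y x, and_comm] using h.2⟩⟩
        loopless := ⟨fun _ h => h.1 rfl⟩ } }

/-- Local complementation along the edge between `a` and `b`. -/
def localCompEdge (G : StabGraph V) (a b : V) : StabGraph V :=
  ((G.localComp a).localComp b).localComp a

/-- A graph is reduced if hollow nodes have no loops and are not connected to each other. -/
def IsReduced (G : StabGraph V) : Prop :=
  (∀ v ∈ G.hollow, v ∉ G.loops) ∧ ∀ a ∈ G.hollow, ∀ b ∈ G.hollow, ¬ G.edges.Adj a b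

/-! ### The equivalence rules -/

open scoped Classical in
/-- Rule E1 on the node `v` (to be used when `v` has a loop): flip the fill of `v`, perform local
complementation on `v`, advance the loops of its neighbors and flip the sign of `v`; if `v` now
has a minus sign, flip the signs of its neighbors. -/
noncomputable def ruleE1 (G : StabGraph V) (v : V) : StabGraph V :=
  let G₁ := (((G.flipFill {v}).localComp v).advance (G.nbr v)).flipSign {v}
  if v ∈ G₁.minus then G₁.flipSign (G₁.nbr v) else G₁

open scoped Classical in
/-- Rule E2 on the nodes `a`, `b` (to be used when they are connected and have no loops): flip
the fills of both, local complement along the edge between them and flip the signs of the nodes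
that were connected to both; for each of `a`, `b` that had a minus sign in the original graph,
flip its sign and the signs of its current neighbors. -/
noncomputable def ruleE2 (G : StabGraph V) (a b : V) : StabGraph V :=
  let G₁ := ((G.flipFill {a, b}).localCompEdge a b).flipSign (G.nbr a ∩ G.nbr b)
  let G₂ := if a ∈ G.minus then G₁.flipSign ({a} ∪ G₁.nbr a) else G₁
  if b ∈ G.minus then G₂.flipSign ({b} ∪ G₂.nbr b) else G₂

open scoped Classical in
/-- Rule E(i) on a hollow node `h` connected to a solid node `s` with a loop: local complement on
`s` and then on `h`, remove the loop of `s`, advance the loops of the current neighbors of `s`,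
and flip the fills of both. Signs: flip the signs of the nodes originally connected to both `s`
and `h`; if `s` initially had a minus sign, flip its sign and those of its current neighbors; if
`h` initially had a minus sign, flip the signs of its current neighbors. -/
noncomputable def ruleEi (G : StabGraph V) (h s : V) : StabGraph V :=
  let G₁ := ((G.localComp s).localComp h).removeLoop s
  let G₂ := ((G₁.advance (G₁.nbr s)).flipFill {h, s}).flipSign (G.nbr s ∩ G.nbr h)
  let G₃ := if s ∈ G.minus then G₂.flipSign ({s} ∪ G₂.nbr s) else G₂
  if h ∈ G.minus then G₃.flipSign (G₃.nbr h) else G₃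

open scoped Classical in
/-- Rule E(ii) on a hollow node `h` connected to a solid node `s` without a loop: local
complement along the edge between them and flip the fills of both, with signs as in E2. -/
noncomputable def ruleEii (G : StabGraph V) (h s : V) : StabGraph V :=
  let G₁ := ((G.localCompEdge h s).flipFill {h, s}).flipSign (G.nbr h ∩ G.nbr s)
  let G₂ := if h ∈ G.minus then G₁.flipSign ({h} ∪ G₁.nbr h) else G₁
  if s ∈ G.minus then G₂.flipSign ({s} ∪ G₂.nbr s) else G₂

/-- `G'` results from `G` by one application of E1 or E2. -/
inductive Step : StabGraph V → StabGraph V → Prop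
  | e1 (G : StabGraph V) (v : V) (hv : v ∈ G.loops) : Step G (G.ruleE1 v)
  | e2 (G : StabGraph V) (a b : V) (hab : G.edges.Adj a b) (ha : a ∉ G.loops)
      (hb : b ∉ G.loops) : Step G (G.ruleE2 a b)

/-- `G'` results from the reduced graph `G` by one application of E(i) or E(ii). -/
inductive ReducedStep : StabGraph V → StabGraph V → Prop
  | ei (G : StabGraph V) (hG : G.IsReduced) (h s : V) (hh : h ∈ G.hollow) (hs : s ∉ G.hollow)
      (hhs : G.edges.Adj h s) (hl : s ∈ G.loops) : ReducedStep G (G.ruleEi h s)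
  | eii (G : StabGraph V) (hG : G.IsReduced) (h s : V) (hh : h ∈ G.hollow) (hs : s ∉ G.hollow)
      (hhs : G.edges.Adj h s) (hl : s ∉ G.loops) : ReducedStep G (G.ruleEii h s)

end StabGraph

/-! Up to a fixed scalar the state is a Hadamard layer on the hollow nodes applied to the vector
`phase`, whose entries are fourth roots of unity with a quadratic exponent. Such a vector is
determined by its value at `0` and its behavior when one bit is set (`eq_of_update_one`). Soundness
therefore asks what one or two Hadamards do to it. A looped node produces a factor `1 ± i` governed
by a parity; a connected pair without loops produces the sign `(-1)^(pq)` of two parities. Expanding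
these over the bits gives E1 and E2 respectively.

For fixed hollow nodes the Hadamard layer can be undone and the graph read off the amplitudes
(`Equivalent.eq_of_hollow_eq`). Hence E1 and E2 are involutions, and completeness is a question
about hollow sets only. A graph that is not reduced admits a rule lowering its number of hollow
nodes, so every graph reaches a reduced one.

For reduced graphs the hollow sets obey a basis exchange (`IsReduced.exists_adj_of_mem_of_notMem`).
On the support of the state a hollow bit is a function of its neighbors' bits, while the bits of
solid nodes are free. So a node hollow only in the first graph has a neighbor hollow in the second,
and E(i) or E(ii) swaps the two fills. Iterating reaches the second graph without changing the
number of hollow nodes, which also gives minimality. -/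

namespace StabGraph

variable {V : Type*}

/-! ### Characters of bit strings -/

section Sign

variable [Fintype V]

open scoped Classical in
/-- The sign `(-1)^(∑_{w ∈ S} x_w)`. -/
noncomputable def setSign (S : Set V) (x : V → Fin 2) : ℂ :=
  ∏ w, if w ∈ S ∧ x w = 1 then -1 else 1

lemma setSign_congr {S T : Set V} {x y : V → Fin 2}
    (h : ∀ w, (w ∈ S ∧ x w = 1) ↔ (w ∈ T ∧ y w = 1)) : setSign S x = setSign T y := by
  classical
  exact Finset.prod_congr rfl fun w _ => by simp only [h w]

/-- Products of characters become symmetric differences of sets; for this reason neighborhoods below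
are written with `∆` wherever possible. -/
lemma setSign_symmDiff (S T : Set V) (x : V → Fin 2) :
    setSign (S ∆ T) x = setSign S x * setSign T x := by
  classical
  unfold setSign
  rw [← Finset.prod_mul_distrib]
  refine Finset.prod_congr rfl fun w _ => ?_
  by_cases hS : w ∈ S <;> by_cases hT : w ∈ T <;> by_cases hx : x w = 1 <;>
    simp [Set.mem_symmDiff, hS, hT, hx]

lemma setSign_eq_or (S : Set V) (x : V → Fin 2) : setSign S x = 1 ∨ setSign S x = -1 := by
  classical
  unfold setSign
  refine Finset.prod_induction _ (fun z : ℂ => z = 1 ∨ z = -1) ?_ (Or.inl rfl) ?_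
  · rintro a b (rfl | rfl) (rfl | rfl) <;> simp
  · intro w _
    split_ifs <;> simp

lemma setSign_zero (S : Set V) : setSign S (0 : V → Fin 2) = 1 := by
  simp [setSign]

@[simp] lemma setSign_empty (x : V → Fin 2) : setSign ∅ x = 1 := by
  simp [setSign]

open scoped Classical in
lemma setSign_singleton (a : V) (x : V → Fin 2) :
    setSign {a} x = if x a = 1 then -1 else 1 := by
  unfold setSign
  rw [Finset.prod_eq_single a] <;> simp +contextual

variable [DecidableEq V]

open scoped Classical in
lemma setSign_update_one (S : Set V) {x : V → Fin 2} {u : V} (hu : x u = 0) :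
    setSign S (Function.update x u 1) = (if u ∈ S then -1 else 1) * setSign S x := by
  have : (if u ∈ S then -1 else 1 : ℂ) = ∏ w, if w = u ∧ u ∈ S then -1 else 1 := by
    rw [Finset.prod_eq_single u] <;> simp +contextual
  rw [this]
  unfold setSign
  rw [← Finset.prod_mul_distrib]
  refine Finset.prod_congr rfl fun w _ => ?_
  by_cases hw : w = u
  · subst hw; simp [hu]
  · simp [hw]

lemma setSign_update_of_notMem {S : Set V} {u : V} (hu : u ∉ S) (x : V → Fin 2) (t : Fin 2) :
    setSign S (Function.update x u t) = setSign S x := by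
  refine setSign_congr fun w => ?_
  by_cases hw : w = u
  · subst hw; simp [hu]
  · simp [hw]

end Sign

/-! ### The amplitudes before the terminal Hadamard gates -/

section Phase

open scoped Classical in
/-- The phase contributed by the loop and the sign of a node with bit `1`. -/
noncomputable def nodeWeight (G : StabGraph V) (v : V) : ℂ :=
  (if v ∈ G.loops then Complex.I else 1) * (if v ∈ G.minus then -1 else 1)

lemma nodeWeight_ne_zero (G : StabGraph V) (v : V) : G.nodeWeight v ≠ 0 := by
  classical
  unfold nodeWeight
  split_ifs <;> simp

variable [Fintype V] [DecidableEq V]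

open scoped Classical in
/-- The amplitudes, relative to that of `|0…0⟩`, before the terminal Hadamard gates. -/
noncomputable def phase (G : StabGraph V) (x : V → Fin 2) : ℂ :=
  (∏ e : Sym2 V, if e ∈ G.edges.edgeSet ∧ ∀ v ∈ e, x v = 1 then (-1 : ℂ) else 1) *
    ∏ v, if x v = 1 then G.nodeWeight v else 1

lemma phase_zero (G : StabGraph V) : G.phase 0 = 1 := by
  classical
  unfold phase
  rw [Finset.prod_eq_one, Finset.prod_eq_one]
  · simp
  · intro v _; simp
  · intro e _
    induction e with | _ a b => exact if_neg fun h => by simpa using h.2 a (by simp)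

lemma phase_ne_zero (G : StabGraph V) (x : V → Fin 2) : G.phase x ≠ 0 := by
  classical
  unfold phase
  refine mul_ne_zero (Finset.prod_ne_zero_iff.2 fun e _ => ?_)
    (Finset.prod_ne_zero_iff.2 fun v _ => ?_)
  · split_ifs <;> simp
  · split_ifs
    · exact G.nodeWeight_ne_zero v
    · simp

open scoped Classical in
-- Setting the bit of `u` activates exactly the edges from `u` to neighbors with bit `1`; reindexing
-- by the other end point gives a character.
lemma prod_edges_update_one (Γ : SimpleGraph V) {x : V → Fin 2} {u : V} (hu : x u = 0) :
    (∏ e : Sym2 V, if e ∈ Γ.edgeSet ∧ ∀ v ∈ e, Function.update x u 1 v = 1 then (-1 : ℂ) else 1) =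
      setSign (Γ.neighborSet u) x *
        ∏ e : Sym2 V, if e ∈ Γ.edgeSet ∧ ∀ v ∈ e, x v = 1 then (-1 : ℂ) else 1 := by
  have key : setSign (Γ.neighborSet u) x =
      ∏ e : Sym2 V, if u ∈ e ∧ e ∈ Γ.edgeSet ∧ ∀ v ∈ e, v ≠ u → x v = 1 then (-1 : ℂ) else 1 := by
    unfold setSign
    refine Fintype.prod_of_injective (fun w => s(u, w)) (fun a b h => Sym2.congr_right.1 h) _ _ ?_ ?_
    · intro e he
      rw [if_neg]
      rintro ⟨hue, -⟩
      obtain ⟨w, rfl⟩ := hue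
      exact he ⟨w, rfl⟩
    · intro w
      by_cases h : Γ.Adj u w
      · have := h.ne'
        simp [h, this]
      · simp [h]
  rw [key, ← Finset.prod_mul_distrib]
  refine Finset.prod_congr rfl fun e _ => ?_
  by_cases he : e ∈ Γ.edgeSet
  · by_cases hue : u ∈ e
    · have h1 : ¬ ∀ v ∈ e, x v = 1 := fun h => by simpa [hu] using h u hue
      have h2 : (∀ v ∈ e, Function.update x u 1 v = 1) ↔ ∀ v ∈ e, v ≠ u → x v = 1 := by
        refine forall₂_congr fun v _ => ?_
        by_cases hv : v = u
        · subst hv; simp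
        · simp [hv]
      simp only [he, hue, h1, h2, true_and, if_false, mul_one]
    · have h2 : (∀ v ∈ e, Function.update x u 1 v = 1) ↔ ∀ v ∈ e, x v = 1 := by
        refine forall₂_congr fun v hv => ?_
        have : v ≠ u := by rintro rfl; exact hue hv
        simp [this]
      simp only [hue, h2, false_and, if_false, one_mul]
  · simp [he]

lemma phase_update_one (G : StabGraph V) {x : V → Fin 2} {u : V} (hu : x u = 0) :
    G.phase (Function.update x u 1) = G.nodeWeight u * setSign (G.nbr u) x * G.phase x := by
  classical
  have key : (∏ v, if Function.update x u 1 v = 1 then G.nodeWeight v else 1) =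
      G.nodeWeight u * ∏ v, if x v = 1 then G.nodeWeight v else 1 := by
    have : G.nodeWeight u = ∏ v, if v = u then G.nodeWeight v else 1 := by simp
    rw [this, ← Finset.prod_mul_distrib]
    refine Finset.prod_congr rfl fun v _ => ?_
    by_cases hv : v = u
    · subst hv; simp [hu]
    · simp [hv]
  unfold phase nbr
  rw [prod_edges_update_one _ hu, key]
  ring

/-- Functions of bit strings that agree at `0` and change in the same way when a bit is set
are equal. -/
lemma eq_of_update_one {f g : (V → Fin 2) → ℂ} (h0 : f 0 = g 0) (r : V → (V → Fin 2) → ℂ)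
    (hf : ∀ u x, x u = 0 → f (Function.update x u 1) = r u x * f x)
    (hg : ∀ u x, x u = 0 → g (Function.update x u 1) = r u x * g x) : f = g := by
  classical
  have key : ∀ s : Finset V, f (fun v => if v ∈ s then 1 else 0) =
      g (fun v => if v ∈ s then 1 else 0) := by
    intro s
    induction s using Finset.induction_on with
    | empty => simpa [Pi.zero_def] using h0
    | insert a s ha ih =>
      have : (fun v => if v ∈ insert a s then (1 : Fin 2) else 0) =
          Function.update (fun v => if v ∈ s then 1 else 0) a 1 := by
        ext v
        by_cases hv : v = a
        · subst hv; simp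
        · simp [hv]
      rw [this, hf _ _ (by simp [ha]), hg _ _ (by simp [ha]), ih]
  ext x
  convert key (Finset.univ.filter fun v => x v = 1) using 2 <;>
  · ext v
    have : x v = 0 ∨ x v = 1 := by omega
    rcases this with h | h <;> simp [h]

end Phase

/-! ### Layers of Hadamard gates -/

section Hadamard

lemma gateH_apply (i j : Fin 2) :
    gateH i j = ((1 / Real.sqrt 2 : ℝ) : ℂ) * if i = 1 ∧ j = 1 then -1 else 1 := by
  fin_cases i <;> fin_cases j <;> simp [gateH]

lemma inv_sqrt_two_sq : ((1 / Real.sqrt 2 : ℝ) : ℂ) * ((1 / Real.sqrt 2 : ℝ) : ℂ) = 1 / 2 := by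
  rw [← Complex.ofReal_mul, div_mul_div_comm, Real.mul_self_sqrt (by norm_num)]
  norm_num

lemma gateH_mul_gateH : gateH * gateH = 1 := by
  have h := inv_sqrt_two_sq
  ext i j
  rw [Matrix.mul_apply, Fin.sum_univ_two]
  simp only [gateH_apply]
  fin_cases i <;> fin_cases j <;> simp at h ⊢ <;> linear_combination 2 * h

variable [Fintype V]

lemma tensorGate_mul [DecidableEq V] (U W : V → Matrix (Fin 2) (Fin 2) ℂ) :
    tensorGate U * tensorGate W = tensorGate fun v => U v * W v := by
  ext x y
  simp only [tensorGate, Matrix.mul_apply, Matrix.of_apply, ← Finset.prod_mul_distrib]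
  rw [Finset.prod_univ_sum, Fintype.piFinset_univ]

open scoped Classical in
/-- Hadamard gates on the qubits in `A`. -/
noncomputable def hadamardLayer (A : Set V) : Matrix (V → Fin 2) (V → Fin 2) ℂ :=
  tensorGate fun v => if v ∈ A then gateH else 1

lemma hadamardLayer_mul [DecidableEq V] (A B : Set V) :
    (hadamardLayer A * hadamardLayer B : Matrix (V → Fin 2) (V → Fin 2) ℂ) =
      hadamardLayer (A ∆ B) := by
  classical
  unfold hadamardLayer
  rw [tensorGate_mul]
  congr 1
  ext1 v
  by_cases hA : v ∈ A <;> by_cases hB : v ∈ B <;>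
    simp [hA, hB, Set.mem_symmDiff, gateH_mul_gateH]

lemma hadamardLayer_apply_ne_zero {A : Set V} {x y : V → Fin 2} (h : hadamardLayer A x y ≠ 0)
    {v : V} (hv : v ∉ A) : x v = y v := by
  classical
  by_contra hne
  refine h (Finset.prod_eq_zero (Finset.mem_univ v) ?_)
  simp [hv, hne]

lemma hadamardLayer_empty : (hadamardLayer ∅ : Matrix (V → Fin 2) (V → Fin 2) ℂ) = 1 := by
  classical
  ext x y
  simp only [hadamardLayer, tensorGate, Matrix.of_apply, Set.mem_empty_iff_false, if_false]
  by_cases h : x = y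
  · subst h; simp
  · obtain ⟨v, hv⟩ := Function.ne_iff.1 h
    rw [Matrix.one_apply_ne h]
    exact Finset.prod_eq_zero (Finset.mem_univ v) (by simp [hv])

variable [DecidableEq V]

lemma hadamardLayer_mulVec_cancel (A : Set V) (f : (V → Fin 2) → ℂ) :
    hadamardLayer A *ᵥ (hadamardLayer A *ᵥ f) = f := by
  rw [Matrix.mulVec_mulVec, hadamardLayer_mul, symmDiff_self, Set.bot_eq_empty,
    hadamardLayer_empty, Matrix.one_mulVec]

lemma hadamardLayer_singleton_mulVec (v : V) (f : (V → Fin 2) → ℂ) (x : V → Fin 2) :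
    (hadamardLayer {v} *ᵥ f) x = ((1 / Real.sqrt 2 : ℝ) : ℂ) *
      (f (Function.update x v 0) + setSign {v} x * f (Function.update x v 1)) := by
  classical
  have hker : ∀ t : Fin 2, hadamardLayer {v} x (Function.update x v t) = gateH (x v) t := by
    intro t
    simp only [hadamardLayer, tensorGate, Matrix.of_apply]
    rw [Finset.prod_eq_single v] <;> simp +contextual [Matrix.one_apply]
  have : (hadamardLayer {v} *ᵥ f) x =
      ∑ t : Fin 2, gateH (x v) t * f (Function.update x v t) := by
    rw [Matrix.mulVec, dotProduct]
    symm
    refine Fintype.sum_of_injective (fun t => Function.update x v t)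
      (Function.update_injective x v) _ _ ?_ ?_
    · intro y hy
      by_contra hne
      refine hy ⟨y v, ?_⟩
      ext w
      by_cases hw : w = v
      · subst hw; simp
      · have := hadamardLayer_apply_ne_zero (left_ne_zero_of_mul hne) (v := w) (by simpa using hw)
        simp [hw, this]
    · intro t
      rw [hker]
  rw [this, Fin.sum_univ_two, gateH_apply, gateH_apply, setSign_singleton]
  by_cases h : x v = 1 <;> simp [h] <;> ring

end Hadamard

/-! ### Normal form of the state and uniqueness of the graph for given hollow nodes -/

section State

lemma tensorGate_diagonal [Fintype V] (d : V → Fin 2 → ℂ) :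
    tensorGate (fun v => Matrix.diagonal (d v)) = Matrix.diagonal fun x => ∏ v, d v (x v) := by
  ext x y
  simp only [tensorGate, Matrix.of_apply]
  by_cases h : x = y
  · subst h; simp
  · obtain ⟨v, hv⟩ := Function.ne_iff.1 h
    rw [Matrix.diagonal_apply_ne _ h]
    exact Finset.prod_eq_zero (Finset.mem_univ v) (by simp [hv])

open scoped Classical in
lemma terminalGate_eq (G : StabGraph V) (v : V) :
    G.terminalGate v = (if v ∈ G.hollow then gateH else 1) *
      Matrix.diagonal fun t : Fin 2 => if t = 1 then G.nodeWeight v else 1 := by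
  rw [terminalGate, mul_assoc]
  congr 1
  ext i j
  by_cases hl : v ∈ G.loops <;> by_cases hm : v ∈ G.minus <;> fin_cases i <;> fin_cases j <;>
    simp [hl, hm, gateS, gateZ, nodeWeight]

variable [Fintype V] [DecidableEq V]

lemma state_eq (G : StabGraph V) :
    G.state = ((1 / Real.sqrt 2 : ℝ) : ℂ) ^ Fintype.card V •
      (hadamardLayer G.hollow *ᵥ G.phase) := by
  classical
  have h1 : (tensorGate (fun _ : V => gateH) *ᵥ ketZero) =
      fun _ => ((1 / Real.sqrt 2 : ℝ) : ℂ) ^ Fintype.card V := by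
    ext x
    simp only [ketZero, Matrix.mulVec_single_one, Matrix.col_apply, tensorGate, Matrix.of_apply,
      gateH_apply]
    simp
  have h2 : tensorGate G.terminalGate = hadamardLayer G.hollow *
      Matrix.diagonal fun x : V → Fin 2 => ∏ v, if x v = 1 then G.nodeWeight v else 1 := by
    rw [← tensorGate_diagonal fun v t => if t = 1 then G.nodeWeight v else 1, hadamardLayer,
      tensorGate_mul]
    exact congrArg tensorGate (funext G.terminalGate_eq)
  rw [state, h1, h2, ← Matrix.mulVec_mulVec, ← Matrix.mulVec_smul]
  congr 1
  ext x
  rw [czLayer, Matrix.mulVec_diagonal, Matrix.mulVec_diagonal, Pi.smul_apply, phase, smul_eq_mul]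
  ring

lemma inv_sqrt_two_pow_ne_zero (n : ℕ) : ((1 / Real.sqrt 2 : ℝ) : ℂ) ^ n ≠ 0 := by
  simp

lemma Equivalent.refl (G : StabGraph V) : G.Equivalent G := ⟨1, by simp, by simp⟩

lemma Equivalent.symm {G G' : StabGraph V} (h : G.Equivalent G') : G'.Equivalent G := by
  obtain ⟨c, hc, h⟩ := h
  have : c ≠ 0 := by rintro rfl; simp at hc
  exact ⟨c⁻¹, by simp [hc], by rw [h, smul_smul, inv_mul_cancel₀ this, one_smul]⟩

lemma Equivalent.trans {G G' G'' : StabGraph V} (h : G.Equivalent G') (h' : G'.Equivalent G'') :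
    G.Equivalent G'' := by
  obtain ⟨c, hc, h⟩ := h
  obtain ⟨d, hd, h'⟩ := h'
  exact ⟨d * c, by simp [hc, hd], by rw [h', h, smul_smul]⟩

/-- Hadamard layers compose by symmetric difference, so only the qubits whose fill changes have to
be compared. -/
lemma equivalent_of_hadamardLayer {G G' : StabGraph V} (A : Set V)
    (hA : G'.hollow = G.hollow ∆ A) {c : ℂ} (hc : ‖c‖ = 1)
    (h : hadamardLayer A *ᵥ G.phase = c • G'.phase) : G.Equivalent G' := by
  refine Equivalent.symm ⟨c, hc, ?_⟩
  have : G.hollow = G'.hollow ∆ A := by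
    rw [hA, symmDiff_assoc, symmDiff_self, symmDiff_bot]
  rw [state_eq, state_eq, smul_comm, ← Matrix.mulVec_smul _ c, ← h, Matrix.mulVec_mulVec,
    hadamardLayer_mul, ← this]

/-- A state has at most one graph with a given set of hollow nodes. -/
lemma Equivalent.eq_of_hollow_eq {G G' : StabGraph V} (h : G.Equivalent G')
    (hH : G.hollow = G'.hollow) : G = G' := by
  classical
  obtain ⟨c, -, h⟩ := h
  rw [state_eq, state_eq, smul_comm, hH] at h
  have h1 := congrArg (hadamardLayer G'.hollow *ᵥ ·)
    (smul_right_injective _ (inv_sqrt_two_pow_ne_zero (Fintype.card V)) h)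
  simp only [Matrix.mulVec_smul, hadamardLayer_mulVec_cancel] at h1
  -- Both phase vectors are `1` at the zero string. One-bit strings then reveal loops and signs,
  -- two-bit strings the edges.
  have hc : c = 1 := by simpa [phase_zero] using (congrFun h1 0).symm
  have hp : G'.phase = G.phase := by rw [h1, hc, one_smul]
  have hw : ∀ u, G'.nodeWeight u = G.nodeWeight u := by
    intro u
    have := congrFun hp (Function.update 0 u 1)
    rwa [phase_update_one _ (Pi.zero_apply u), phase_update_one _ (Pi.zero_apply u),
      setSign_zero, setSign_zero, phase_zero, phase_zero, mul_one, mul_one, mul_one, mul_one] at this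
  have hn : ∀ u w, G'.edges.Adj u w ↔ G.edges.Adj u w := by
    intro u w
    by_cases huw : u = w
    · subst huw; simp
    have h0 : (Function.update 0 w 1 : V → Fin 2) u = 0 := by simp [huw]
    have := congrFun hp (Function.update (Function.update 0 w 1) u 1)
    rw [phase_update_one _ h0, phase_update_one _ h0, hp, hw] at this
    have := mul_left_cancel₀ (G.nodeWeight_ne_zero u)
      (mul_right_cancel₀ (G.phase_ne_zero _) this)
    rw [setSign_update_one _ (Pi.zero_apply w), setSign_update_one _ (Pi.zero_apply w),
      setSign_zero, setSign_zero] at this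
    by_cases h1 : G'.edges.Adj u w <;> by_cases h2 : G.edges.Adj u w <;>
      simp [nbr, h1, h2] at this ⊢ <;> norm_num at this
  have hlm : ∀ u, (u ∈ G'.loops ↔ u ∈ G.loops) ∧ (u ∈ G'.minus ↔ u ∈ G.minus) := by
    intro u
    have := hw u
    unfold nodeWeight at this
    by_cases h1 : u ∈ G'.loops <;> by_cases h2 : u ∈ G.loops <;>
      by_cases h3 : u ∈ G'.minus <;> by_cases h4 : u ∈ G.minus <;>
      simp [h1, h2, h3, h4, Complex.ext_iff] at this ⊢ <;> norm_num at this
  ext u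
  · rename_i w
    exact (hn u w).symm
  · rw [hH]
  · exact (hlm u).1.symm
  · exact (hlm u).2.symm

end State

/-! ### The combinatorics of the rules -/

section Rules

lemma mem_nbr_comm {G : StabGraph V} {u w : V} : u ∈ G.nbr w ↔ w ∈ G.nbr u := G.edges.adj_comm w u

lemma notMem_nbr_self (G : StabGraph V) (u : V) : u ∉ G.nbr u := G.edges.irrefl

lemma mem_nbr_localComp {G : StabGraph V} {v u w : V} :
    w ∈ (G.localComp v).nbr u ↔ u ≠ w ∧ Xor (w ∈ G.nbr u) (u ∈ G.nbr v ∧ w ∈ G.nbr v) := Iff.rfl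

lemma nbr_localComp_self (G : StabGraph V) (v : V) : (G.localComp v).nbr v = G.nbr v := by
  ext w
  have := G.notMem_nbr_self v
  rw [mem_nbr_localComp]
  grind [Xor]

lemma nbr_localComp_of_mem {G : StabGraph V} {v u : V} (h : u ∈ G.nbr v) :
    (G.localComp v).nbr u = G.nbr u ∆ G.nbr v ∆ {u} := by
  ext w
  have := G.notMem_nbr_self u
  simp only [mem_nbr_localComp, Set.mem_symmDiff, Set.mem_singleton_iff]
  grind [Xor]

lemma nbr_localComp_of_notMem {G : StabGraph V} {v u : V} (h : u ∉ G.nbr v) :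
    (G.localComp v).nbr u = G.nbr u := by
  ext w
  have := G.notMem_nbr_self u
  rw [mem_nbr_localComp]
  grind [Xor]

/-- The two ends exchange neighborhoods; the singletons remove `a` from its own neighborhood and
restore the edge `ab`. -/
lemma nbr_localCompEdge_left {G : StabGraph V} {a b : V} (h : b ∈ G.nbr a) :
    (G.localCompEdge a b).nbr a = {a} ∆ G.nbr b ∆ {b} := by
  ext w
  have h1 := G.notMem_nbr_self a
  have h2 := G.notMem_nbr_self b
  have h3 := @mem_nbr_comm _ G
  simp only [localCompEdge, mem_nbr_localComp, Set.mem_symmDiff, Set.mem_singleton_iff]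
  grind [Xor]

lemma nbr_localCompEdge_right {G : StabGraph V} {a b : V} (h : b ∈ G.nbr a) :
    (G.localCompEdge a b).nbr b = {a} ∆ G.nbr a ∆ {b} := by
  ext w
  have h1 := G.notMem_nbr_self a
  have h2 := G.notMem_nbr_self b
  have h3 := @mem_nbr_comm _ G
  simp only [localCompEdge, mem_nbr_localComp, Set.mem_symmDiff, Set.mem_singleton_iff]
  grind [Xor]

open scoped Classical in
-- The two conditional sets are those whose characters appear in `hadamardLayer_pair_mulVec_phase`,
-- so the soundness proof of E2 can match factors.
lemma nbr_localCompEdge_of_ne {G : StabGraph V} {a b u : V} (h : b ∈ G.nbr a) (ha : u ≠ a)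
    (hb : u ≠ b) :
    (G.localCompEdge a b).nbr u = (G.nbr u \ {a, b}) ∆
      ((if u ∈ G.nbr a then {a} ∆ G.nbr b ∆ {b} else ∅) ∆
        (if u ∈ G.nbr b then {a} ∆ G.nbr a ∆ {b} else ∅)) := by
  ext w
  have h1 := G.notMem_nbr_self a
  have h2 := G.notMem_nbr_self b
  have h4 := G.notMem_nbr_self u
  have h3 := @mem_nbr_comm _ G
  by_cases hua : u ∈ G.nbr a <;> by_cases hub : u ∈ G.nbr b <;>
  simp only [localCompEdge, mem_nbr_localComp, Set.mem_symmDiff, Set.mem_singleton_iff, hua, hub,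
    if_true, if_false, Set.mem_sdiff, Set.mem_insert_iff, Set.mem_empty_iff_false]
  all_goals grind [Xor]

lemma ruleE1_edges (G : StabGraph V) (v : V) : (G.ruleE1 v).edges = (G.localComp v).edges := by
  dsimp only [ruleE1]
  split_ifs <;> rfl

lemma ruleE1_hollow (G : StabGraph V) (v : V) : (G.ruleE1 v).hollow = G.hollow ∆ {v} := by
  dsimp only [ruleE1]
  split_ifs <;> rfl

lemma ruleE1_loops (G : StabGraph V) (v : V) : (G.ruleE1 v).loops = G.loops ∆ G.nbr v := by
  dsimp only [ruleE1]
  split_ifs <;> rfl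

lemma ruleE1_nbr (G : StabGraph V) (v : V) : (G.ruleE1 v).nbr = (G.localComp v).nbr := by
  unfold nbr
  rw [ruleE1_edges]

/-- Two flips can reach a neighbor: advancing an existing loop, and the new sign of `v`, which is
opposite to the old one. They cancel when both occur. -/
lemma mem_ruleE1_minus (G : StabGraph V) (u v : V) :
    u ∈ (G.ruleE1 v).minus ↔
      Xor (Xor (u ∈ G.minus) (u = v)) (u ∈ G.nbr v ∧ ¬ (u ∈ G.loops ↔ v ∉ G.minus)) := by
  have := G.notMem_nbr_self v
  have e : ((((G.flipFill {v}).localComp v).advance (G.nbr v)).flipSign {v}).nbr v =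
    G.nbr v := G.nbr_localComp_self v
  have e2 : v ∈ ((((G.flipFill {v}).localComp v).advance (G.nbr v)).flipSign {v}).minus ↔
      v ∉ G.minus := by
    by_cases hm : v ∈ G.minus <;>
      simp [flipSign, advance, localComp, flipFill, Set.mem_symmDiff, this, hm]
  unfold ruleE1
  simp only [e2, e]
  split_ifs with hm <;>
    simp only [flipSign, advance, localComp, flipFill, Set.mem_symmDiff, Set.mem_singleton_iff,
      Set.mem_inter_iff] <;> grind [Xor]

lemma ruleE2_edges (G : StabGraph V) (a b : V) :
    (G.ruleE2 a b).edges = (G.localCompEdge a b).edges := by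
  unfold ruleE2
  split_ifs <;> rfl

lemma ruleE2_hollow (G : StabGraph V) (a b : V) :
    (G.ruleE2 a b).hollow = G.hollow ∆ {a, b} := by
  unfold ruleE2
  split_ifs <;> rfl

lemma ruleE2_loops (G : StabGraph V) (a b : V) : (G.ruleE2 a b).loops = G.loops := by
  unfold ruleE2
  split_ifs <;> rfl

lemma ruleE2_nbr (G : StabGraph V) (a b : V) :
    (G.ruleE2 a b).nbr = (G.localCompEdge a b).nbr := by
  unfold nbr
  rw [ruleE2_edges]

lemma mem_ruleE2_minus (G : StabGraph V) (a b u : V) :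
    u ∈ (G.ruleE2 a b).minus ↔
      Xor (Xor (Xor (u ∈ G.minus) (u ∈ G.nbr a ∧ u ∈ G.nbr b))
        (a ∈ G.minus ∧ (u = a ∨ u ∈ (G.localCompEdge a b).nbr a)))
        (b ∈ G.minus ∧ (u = b ∨ u ∈ (G.localCompEdge a b).nbr b)) := by
  have e : ∀ A : Set V, ∀ w, (((G.flipFill {a, b}).localCompEdge a b).flipSign A).nbr w =
    (G.localCompEdge a b).nbr w := fun _ _ => rfl
  have e' : ∀ A B : Set V, ∀ w,
    ((((G.flipFill {a, b}).localCompEdge a b).flipSign A).flipSign B).nbr w =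
      (G.localCompEdge a b).nbr w := fun _ _ _ => rfl
  unfold ruleE2
  split_ifs with h1 h2 h2 <;> simp only [e, e', h1, h2, true_and, false_and] <;>
    simp [flipSign, flipFill, localComp, localCompEdge, Set.mem_symmDiff, Xor]

lemma ruleEii_eq_ruleE2 (G : StabGraph V) (a b : V) : G.ruleEii a b = G.ruleE2 a b := rfl

lemma mem_ruleEi_minus (G : StabGraph V) (h s u : V) :
    u ∈ (G.ruleEi h s).minus ↔
      Xor (Xor (Xor (Xor (u ∈ G.minus)
        (u ∈ G.loops ∧ u ≠ s ∧ u ∈ ((G.localComp s).localComp h).nbr s))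
        (u ∈ G.nbr s ∧ u ∈ G.nbr h))
        (s ∈ G.minus ∧ (u = s ∨ u ∈ ((G.localComp s).localComp h).nbr s)))
        (h ∈ G.minus ∧ u ∈ ((G.localComp s).localComp h).nbr h) := by
  have e : ∀ A B C w, ((((((G.localComp s).localComp h).removeLoop s).advance A).flipFill
    B).flipSign C).nbr w = ((G.localComp s).localComp h).nbr w := fun _ _ _ _ => rfl
  have e' : ∀ A B C D w, (((((((G.localComp s).localComp h).removeLoop s).advance A).flipFill
    B).flipSign C).flipSign D).nbr w = ((G.localComp s).localComp h).nbr w := fun _ _ _ _ _ => rfl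
  have e'' : ∀ w, (((G.localComp s).localComp h).removeLoop s).nbr w =
    ((G.localComp s).localComp h).nbr w := fun _ => rfl
  unfold ruleEi
  split_ifs with h1 h2 h2 <;> simp only [e, e', e'', h1, h2, true_and, false_and] <;>
    simp [flipSign, flipFill, localComp, removeLoop, advance, Set.mem_symmDiff, Xor, and_assoc]

lemma ruleEi_edges (G : StabGraph V) (h s : V) :
    (G.ruleEi h s).edges = ((G.localComp s).localComp h).edges := by
  dsimp only [ruleEi]
  split_ifs <;> rfl

lemma ruleEi_hollow (G : StabGraph V) (h s : V) :
    (G.ruleEi h s).hollow = G.hollow ∆ {h, s} := by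
  dsimp only [ruleEi]
  split_ifs <;> rfl

lemma ruleEi_loops (G : StabGraph V) (h s : V) :
    (G.ruleEi h s).loops = (G.loops \ {s}) ∆ ((G.localComp s).localComp h).nbr s := by
  dsimp only [ruleEi]
  split_ifs <;> rfl

/-- E1 on `s` gives `h` a loop, which makes E1 on `h` available; that second use advances the loop
of `s` away. -/
lemma ruleEi_eq_ruleE1_ruleE1 {G : StabGraph V} {h s : V} (hs : s ∈ G.loops) (hh : h ∉ G.loops)
    (hhs : s ∈ G.nbr h) : G.ruleEi h s = (G.ruleE1 s).ruleE1 h := by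
  have hne : h ≠ s := by rintro rfl; exact hh hs
  have h1 := G.notMem_nbr_self h
  have h2 := G.notMem_nbr_self s
  have h3 := @mem_nbr_comm _ G
  have hE : ∀ u w, w ∈ ((G.localComp s).localComp h).nbr u ↔
    w ∈ ((G.ruleE1 s).localComp h).nbr u := by
    intro u w
    simp only [mem_nbr_localComp, ruleE1_nbr]
  ext u
  · rename_i w
    rw [ruleEi_edges, ruleE1_edges]
    exact hE u w
  · rw [ruleEi_hollow, ruleE1_hollow, ruleE1_hollow]
    simp only [Set.mem_symmDiff, Set.mem_insert_iff, Set.mem_singleton_iff]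
    grind
  · rw [ruleEi_loops, ruleE1_loops, ruleE1_loops, ruleE1_nbr]
    simp only [Set.mem_symmDiff, Set.mem_sdiff, Set.mem_singleton_iff, mem_nbr_localComp]
    grind [Xor]
  · simp only [mem_ruleEi_minus, mem_ruleE1_minus, ruleE1_nbr, ruleE1_loops, Set.mem_symmDiff,
      mem_nbr_localComp]
    by_cases hus : u = s
    · subst hus
      grind [Xor]
    by_cases huh : u = h
    · subst huh
      grind [Xor]
    by_cases hu1 : u ∈ G.nbr s <;> by_cases hu2 : u ∈ G.nbr h <;>
    by_cases hu3 : u ∈ G.loops <;> by_cases hu4 : s ∈ G.minus <;> by_cases hu5 : h ∈ G.minus <;>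
      by_cases hu6 : u ∈ G.minus <;> grind [Xor]

end Rules

/-! ### Soundness of the rules -/

section Soundness

lemma nodeWeight_ruleE1_self {G : StabGraph V} {v : V} (hv : v ∈ G.loops) :
    (G.ruleE1 v).nodeWeight v = -G.nodeWeight v := by
  have := G.notMem_nbr_self v
  unfold nodeWeight
  by_cases hm : v ∈ G.minus <;>
  simp [ruleE1_loops, mem_ruleE1_minus, Set.mem_symmDiff, hv, this, hm]

/-- Advancing multiplies the weight by `i`, and the extra sign flip occurs exactly when `v` had no
sign; together they give minus the weight of `v`. -/
lemma nodeWeight_ruleE1_of_mem {G : StabGraph V} {u v : V} (hv : v ∈ G.loops)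
    (hu : u ∈ G.nbr v) : (G.ruleE1 v).nodeWeight u = -(G.nodeWeight v * G.nodeWeight u) := by
  have : u ≠ v := by rintro rfl; exact G.notMem_nbr_self _ hu
  unfold nodeWeight
  by_cases hm : v ∈ G.minus <;> by_cases hm' : u ∈ G.minus <;> by_cases hl : u ∈ G.loops <;>
  simp [ruleE1_loops, mem_ruleE1_minus, Set.mem_symmDiff, hv, this, hm, hm', hu, hl]

lemma nodeWeight_ruleE1_of_notMem {G : StabGraph V} {u v : V}
    (hu : u ∉ G.nbr v) (huv : u ≠ v) : (G.ruleE1 v).nodeWeight u = G.nodeWeight u := by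
  have h1 : u ∈ (G.ruleE1 v).loops ↔ u ∈ G.loops := by
    simp [ruleE1_loops, Set.mem_symmDiff, hu]
  have h2 : u ∈ (G.ruleE1 v).minus ↔ u ∈ G.minus := by simp [mem_ruleE1_minus, hu, huv, Xor]
  by_cases h3 : u ∈ G.loops <;> by_cases h4 : u ∈ G.minus <;> simp [nodeWeight, h1, h2, h3, h4]

lemma nodeWeight_sq_of_loop {G : StabGraph V} {v : V} (hv : v ∈ G.loops) :
    G.nodeWeight v * G.nodeWeight v = -1 := by
  unfold nodeWeight
  by_cases hm : v ∈ G.minus <;> simp [hv, hm]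

lemma norm_inv_sqrt_two_mul_one_add {G : StabGraph V} {v : V} (hv : v ∈ G.loops) :
    ‖((1 / Real.sqrt 2 : ℝ) : ℂ) * (1 + G.nodeWeight v)‖ = 1 := by
  have h : ‖1 + G.nodeWeight v‖ = Real.sqrt 2 := by
    rw [Complex.norm_def]
    congr 1
    unfold nodeWeight
    by_cases hm : v ∈ G.minus <;> simp [hv, hm, Complex.normSq_apply] <;> norm_num
  rw [norm_mul, h, Complex.norm_real, Real.norm_of_nonneg (by positivity)]
  exact one_div_mul_cancel (by positivity)

lemma nodeWeight_mul_self_of_notMem {G : StabGraph V} {v : V} (hv : v ∉ G.loops) :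
    G.nodeWeight v * G.nodeWeight v = 1 := by
  unfold nodeWeight
  by_cases hm : v ∈ G.minus <;> simp [hv, hm]

/-- A sign on `a` cancels itself, and a sign on `b` is carried over by the surviving edge, so the
two weights are exchanged. -/
lemma nodeWeight_ruleE2_left {G : StabGraph V} {a b : V} (hab : b ∈ G.nbr a) (ha : a ∉ G.loops)
    (hb : b ∉ G.loops) : (G.ruleE2 a b).nodeWeight a = G.nodeWeight b := by
  have h1 : a ∈ (G.ruleE2 a b).minus ↔ b ∈ G.minus := by
    have h1 := G.notMem_nbr_self a
    have h2 := (G.localCompEdge a b).notMem_nbr_self a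
    have h3 := @mem_nbr_comm _ G
    simp only [mem_ruleE2_minus, nbr_localCompEdge_right hab, Set.mem_symmDiff,
      Set.mem_singleton_iff]
    grind [Xor]
  by_cases h2 : b ∈ G.minus <;> simp [nodeWeight, h1, ruleE2_loops, ha, hb, h2]

lemma nodeWeight_ruleE2_right {G : StabGraph V} {a b : V} (hab : b ∈ G.nbr a) (ha : a ∉ G.loops)
    (hb : b ∉ G.loops) : (G.ruleE2 a b).nodeWeight b = G.nodeWeight a := by
  have h1 : b ∈ (G.ruleE2 a b).minus ↔ a ∈ G.minus := by
    have h1 := G.notMem_nbr_self b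
    have h2 := (G.localCompEdge a b).notMem_nbr_self b
    have h3 := @mem_nbr_comm _ G
    simp only [mem_ruleE2_minus, nbr_localCompEdge_left hab, Set.mem_symmDiff,
      Set.mem_singleton_iff]
    grind [Xor]
  by_cases h2 : a ∈ G.minus <;> simp [nodeWeight, h1, ruleE2_loops, ha, hb, h2]

open scoped Classical in
lemma nodeWeight_ruleE2_of_ne {G : StabGraph V} {a b u : V} (hab : b ∈ G.nbr a)
    (ha : a ∉ G.loops) (hb : b ∉ G.loops) (hua : u ≠ a) (hub : u ≠ b) :
    (G.ruleE2 a b).nodeWeight u = G.nodeWeight u *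
      ((if u ∈ G.nbr a ∧ u ∈ G.nbr b then -1 else 1) *
        ((if u ∈ G.nbr a then G.nodeWeight b else 1) *
          (if u ∈ G.nbr b then G.nodeWeight a else 1))) := by
  have h1 : u ∈ (G.ruleE2 a b).minus ↔
      Xor (Xor (Xor (u ∈ G.minus) (u ∈ G.nbr a ∧ u ∈ G.nbr b)) (a ∈ G.minus ∧ u ∈ G.nbr b))
        (b ∈ G.minus ∧ u ∈ G.nbr a) := by
    simp only [mem_ruleE2_minus, nbr_localCompEdge_left hab, nbr_localCompEdge_right hab,
      Set.mem_symmDiff, Set.mem_singleton_iff]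
    simp [hua, hub]
  by_cases h2 : u ∈ G.nbr a <;> by_cases h3 : u ∈ G.nbr b <;> by_cases h4 : u ∈ G.minus <;>
    by_cases h5 : a ∈ G.minus <;> by_cases h6 : b ∈ G.minus <;>
    simp [nodeWeight, h1, ruleE2_loops, ha, hb, h2, h3, h4, h5, h6]

variable [Fintype V]

lemma setSign_mul_self (S : Set V) (x : V → Fin 2) : setSign S x * setSign S x = 1 := by
  rcases setSign_eq_or S x with h | h <;> simp [h]

variable [DecidableEq V]

lemma hadamardLayer_singleton_mulVec_phase (G : StabGraph V) (v : V) (x : V → Fin 2) :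
    (hadamardLayer {v} *ᵥ G.phase) x = ((1 / Real.sqrt 2 : ℝ) : ℂ) *
      (G.phase (Function.update x v 0) *
        (1 + G.nodeWeight v * setSign (G.nbr v) x * setSign {v} x)) := by
  have : Function.update x v 1 = Function.update (Function.update x v 0) v 1 := by simp
  rw [hadamardLayer_singleton_mulVec, this, phase_update_one _ (by simp),
    setSign_update_of_notMem (G.notMem_nbr_self v)]
  ring

lemma setSign_update_zero (S : Set V) (x : V → Fin 2) (v : V) :
    setSign S (Function.update x v 0) = setSign (S \ {v}) x := by
  refine setSign_congr fun w => ?_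
  by_cases h : w = v
  · subst h; simp
  · simp [h]

/-- With `w = ±i` the weight of `v`, `1 - w = (1 + w) * (-w)`, so the Hadamard leaves `(-w)` to the
parity of the bits on `v` and its neighbors. Since `w ^ 2 = -1`, expanding that parity gives each of
these nodes a factor `-w` and each pair of them a controlled-`Z`: this is local complementation. -/
lemma hadamardLayer_mulVec_phase_ruleE1 {G : StabGraph V} {v : V} (hv : v ∈ G.loops) :
    hadamardLayer {v} *ᵥ G.phase =
      (((1 / Real.sqrt 2 : ℝ) : ℂ) * (1 + G.nodeWeight v)) • (G.ruleE1 v).phase := by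
  have hw := nodeWeight_sq_of_loop hv
  refine eq_of_update_one ?_
    (fun u x => (G.ruleE1 v).nodeWeight u * setSign ((G.ruleE1 v).nbr u) x) ?_ ?_
  · have : Function.update (0 : V → Fin 2) v 0 = 0 := by simp
    rw [hadamardLayer_singleton_mulVec_phase, this]
    simp [phase_zero, setSign_zero]
  · intro u x hu
    rw [hadamardLayer_singleton_mulVec_phase, hadamardLayer_singleton_mulVec_phase, ruleE1_nbr]
    have hsq := setSign_mul_self (G.nbr v) x
    have hsq' := setSign_mul_self {v} x
    by_cases huv : u = v
    · subst huv
      rw [nodeWeight_ruleE1_self hv, nbr_localComp_self, Function.update_idem,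
        setSign_update_of_notMem (G.notMem_nbr_self u), setSign_update_one _ hu]
      have : setSign {u} x = 1 := by simp [setSign_singleton, hu]
      rw [this]
      simp only [Set.mem_singleton_iff, if_true]
      linear_combination (((1 / Real.sqrt 2 : ℝ) : ℂ) * G.phase (Function.update x u 0)) *
        (hw * setSign (G.nbr u) x * setSign (G.nbr u) x - hsq)
    · rw [Function.update_comm huv, phase_update_one _ (by simp [huv, hu]),
        setSign_update_of_notMem (S := {v}) huv, setSign_update_one _ hu, setSign_update_zero]
      by_cases hn : u ∈ G.nbr v
      · have h1 : G.nbr u \ {v} = G.nbr u ∆ {v} := by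
          ext w
          have := mem_nbr_comm.1 hn
          simp only [Set.mem_sdiff, Set.mem_symmDiff, Set.mem_singleton_iff]
          grind
        have : setSign {u} x = 1 := by simp [setSign_singleton, hu]
        rw [nodeWeight_ruleE1_of_mem hv hn, nbr_localComp_of_mem hn, h1, setSign_symmDiff,
          setSign_symmDiff, setSign_symmDiff, this, if_pos hn]
        linear_combination (((1 / Real.sqrt 2 : ℝ) : ℂ) * G.phase (Function.update x v 0) *
          G.nodeWeight u * setSign (G.nbr u) x) * (-G.nodeWeight v * setSign (G.nbr v) x * hsq' +
          setSign {v} x * setSign (G.nbr v) x * setSign (G.nbr v) x * hw - setSign {v} x * hsq)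
      · have h1 : G.nbr u \ {v} = G.nbr u := by
          ext w
          have := mt mem_nbr_comm.2 hn
          simp only [Set.mem_sdiff, Set.mem_singleton_iff]
          grind
        rw [nodeWeight_ruleE1_of_notMem hn huv, nbr_localComp_of_notMem hn, h1, if_neg hn]
        ring
  · intro u x hu
    rw [Pi.smul_apply, Pi.smul_apply, phase_update_one _ hu, smul_eq_mul, smul_eq_mul]
    ring

lemma equivalent_ruleE1 {G : StabGraph V} {v : V} (hv : v ∈ G.loops) :
    G.Equivalent (G.ruleE1 v) :=
  equivalent_of_hadamardLayer {v} (G.ruleE1_hollow v) (norm_inv_sqrt_two_mul_one_add hv)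
    (hadamardLayer_mulVec_phase_ruleE1 hv)

/-- The four terms are the values of the bits `a` and `b` summed over; the inner minus sign is the
edge between them. -/
lemma hadamardLayer_pair_mulVec_phase {G : StabGraph V} {a b : V} (hab : b ∈ G.nbr a)
    (x : V → Fin 2) :
    (hadamardLayer {a, b} *ᵥ G.phase) x =
      1 / 2 * (G.phase (Function.update (Function.update x a 0) b 0) *
        (1 + G.nodeWeight b * setSign ({a} ∆ G.nbr b ∆ {b}) x +
          G.nodeWeight a * setSign ({a} ∆ G.nbr a ∆ {b}) x *
            (1 - G.nodeWeight b * setSign ({a} ∆ G.nbr b ∆ {b}) x))) := by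
  have hne : a ≠ b := by rintro rfl; exact G.notMem_nbr_self _ hab
  have hba := mem_nbr_comm.1 hab
  have ha := G.notMem_nbr_self a
  have hb := G.notMem_nbr_self b
  have e : ({a, b} : Set V) = {a} ∆ {b} := by
    ext w
    simp only [Set.mem_insert_iff, Set.mem_singleton_iff, Set.mem_symmDiff]
    grind
  have e1 : setSign {a} x * setSign ((G.nbr a \ {b}) \ {a}) x =
      setSign ({a} ∆ G.nbr a ∆ {b}) x := by
    rw [← setSign_symmDiff]
    congr 1
    ext w
    simp only [Set.mem_sdiff, Set.mem_singleton_iff, Set.mem_symmDiff]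
    grind
  have e2 : setSign (G.nbr b \ {a}) x * setSign {b} x = setSign ({a} ∆ G.nbr b ∆ {b}) x := by
    rw [← setSign_symmDiff]
    congr 1
    ext w
    simp only [Set.mem_sdiff, Set.mem_singleton_iff, Set.mem_symmDiff]
    grind
  have u1 : Function.update (Function.update x a 1) b 0 =
      Function.update (Function.update (Function.update x a 0) b 0) a 1 := by
    rw [Function.update_comm hne.symm _ _ (Function.update x a 0), Function.update_idem]
  have u2 : setSign (G.nbr b) (Function.update x a 1) = -setSign (G.nbr b \ {a}) x := by
    have : Function.update x a 1 = Function.update (Function.update x a 0) a 1 := by simp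
    rw [this, setSign_update_one _ (by simp), if_pos hba, setSign_update_zero, neg_one_mul]
  have hb' : a ∉ ({b} : Set V) := hne
  rw [e, ← hadamardLayer_mul, ← Matrix.mulVec_mulVec, hadamardLayer_singleton_mulVec,
    hadamardLayer_singleton_mulVec_phase, hadamardLayer_singleton_mulVec_phase, u1, u2,
    phase_update_one _ (by simp [hne]), setSign_update_of_notMem hb',
    setSign_update_of_notMem hb', setSign_update_zero, setSign_update_zero, setSign_update_zero,
    ← e1, ← e2, ← inv_sqrt_two_sq]
  ring

/-- For signs `P` and `Q`, `1 + Q + P * (1 - Q)` is `-2` when both are `-1` and `2` otherwise: a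
controlled-`Z` between two parities. Expanded over the bits, it toggles the edges as complementation
along `ab` does. -/
lemma hadamardLayer_mulVec_phase_ruleE2 {G : StabGraph V} {a b : V} (hab : b ∈ G.nbr a)
    (ha : a ∉ G.loops) (hb : b ∉ G.loops) :
    hadamardLayer {a, b} *ᵥ G.phase =
      (1 / 2 * (1 + G.nodeWeight b + G.nodeWeight a * (1 - G.nodeWeight b))) •
        (G.ruleE2 a b).phase := by
  classical
  have hne : a ≠ b := by rintro rfl; exact G.notMem_nbr_self _ hab
  have hba := mem_nbr_comm.1 hab
  have hna := G.notMem_nbr_self a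
  have hnb := G.notMem_nbr_self b
  have hwa := nodeWeight_mul_self_of_notMem ha
  have hwb := nodeWeight_mul_self_of_notMem hb
  refine eq_of_update_one ?_
    (fun u x => (G.ruleE2 a b).nodeWeight u * setSign ((G.ruleE2 a b).nbr u) x) ?_ ?_
  · have : Function.update (Function.update (0 : V → Fin 2) a 0) b 0 = 0 := by simp
    rw [hadamardLayer_pair_mulVec_phase hab, this]
    simp [phase_zero, setSign_zero]
  · intro u x hu
    rw [hadamardLayer_pair_mulVec_phase hab, hadamardLayer_pair_mulVec_phase hab, ruleE2_nbr]
    have hα := setSign_mul_self ({a} ∆ G.nbr a ∆ {b}) x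
    have hβ := setSign_mul_self ({a} ∆ G.nbr b ∆ {b}) x
    rw [setSign_update_one _ hu, setSign_update_one _ hu]
    by_cases hua : u = a
    · subst hua
      have h1 : u ∈ {u} ∆ G.nbr u ∆ {b} := by simp [Set.mem_symmDiff, hna, hne]
      have h2 : u ∉ {u} ∆ G.nbr b ∆ {b} := by simp [Set.mem_symmDiff, hba, hne]
      rw [nodeWeight_ruleE2_left hab ha hb, nbr_localCompEdge_left hab, if_pos h1, if_neg h2,
        Function.update_idem]
      generalize setSign ({u} ∆ G.nbr u ∆ {b}) x = α at *
      generalize setSign ({u} ∆ G.nbr b ∆ {b}) x = β at *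
      have h3 : G.nodeWeight b * β * (G.nodeWeight b * β) = 1 := by
        linear_combination β * β * hwb + hβ
      linear_combination (-(1 / 2) * G.phase (Function.update (Function.update x u 0) b 0) *
        (1 - G.nodeWeight u * α)) * h3
    by_cases hub : u = b
    · subst hub
      have h1 : u ∈ {a} ∆ G.nbr u ∆ {u} := by simp [Set.mem_symmDiff, hnb, hne.symm]
      have h2 : u ∉ {a} ∆ G.nbr a ∆ {u} := by simp [Set.mem_symmDiff, hab, hne.symm]
      rw [nodeWeight_ruleE2_right hab ha hb, nbr_localCompEdge_right hab, if_pos h1, if_neg h2,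
        Function.update_comm hua, Function.update_idem]
      generalize setSign ({a} ∆ G.nbr a ∆ {u}) x = α at *
      generalize setSign ({a} ∆ G.nbr u ∆ {u}) x = β at *
      have h3 : G.nodeWeight a * α * (G.nodeWeight a * α) = 1 := by
        linear_combination α * α * hwa + hα
      linear_combination (-(1 / 2) * G.phase (Function.update (Function.update x a 0) u 0) *
        (1 - G.nodeWeight u * β)) * h3
    have h1 : u ∈ {a} ∆ G.nbr a ∆ {b} ↔ u ∈ G.nbr a := by simp [Set.mem_symmDiff, hua, hub]
    have h2 : u ∈ {a} ∆ G.nbr b ∆ {b} ↔ u ∈ G.nbr b := by simp [Set.mem_symmDiff, hua, hub]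
    have h3 : setSign (G.nbr u) (Function.update (Function.update x a 0) b 0) =
        setSign (G.nbr u \ {a, b}) x := by
      rw [setSign_update_zero, setSign_update_zero]
      congr 1
      ext w
      simp only [Set.mem_sdiff, Set.mem_singleton_iff, Set.mem_insert_iff]
      tauto
    rw [nodeWeight_ruleE2_of_ne hab ha hb hua hub, nbr_localCompEdge_of_ne hab hua hub,
      Function.update_comm hua, Function.update_comm hub, phase_update_one _ (by simp [hua, hub, hu]),
      h3, setSign_symmDiff (G.nbr u \ {a, b}), setSign_symmDiff (ite _ _ _)]
    simp only [h1, h2]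
    generalize setSign (G.nbr u \ {a, b}) x = γ at *
    have hA : G.nodeWeight a * setSign ({a} ∆ G.nbr a ∆ {b}) x *
        (G.nodeWeight a * setSign ({a} ∆ G.nbr a ∆ {b}) x) = 1 := by
      linear_combination setSign ({a} ∆ G.nbr a ∆ {b}) x * setSign ({a} ∆ G.nbr a ∆ {b}) x * hwa +
        hα
    have hB : G.nodeWeight b * setSign ({a} ∆ G.nbr b ∆ {b}) x *
        (G.nodeWeight b * setSign ({a} ∆ G.nbr b ∆ {b}) x) = 1 := by
      linear_combination setSign ({a} ∆ G.nbr b ∆ {b}) x * setSign ({a} ∆ G.nbr b ∆ {b}) x * hwb +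
        hβ
    by_cases hA' : u ∈ G.nbr a <;> by_cases hB' : u ∈ G.nbr b <;>
      simp only [hA', hB', if_true, if_false, and_true, and_false, setSign_empty]
    all_goals
      generalize setSign ({a} ∆ G.nbr a ∆ {b}) x = α at *
      generalize setSign ({a} ∆ G.nbr b ∆ {b}) x = β at *
      generalize G.phase (Function.update (Function.update x a 0) b 0) = p at *
      generalize G.nodeWeight a = A at *
      generalize G.nodeWeight b = B at *
      generalize G.nodeWeight u = w at *
    · linear_combination (1 / 2 * w * γ * p) * (A * α * hB + B * β * hA - B * β * (B * β) * hA - hB)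
    · linear_combination (1 / 2 * w * γ * p) * ((A * α - 1) * hB)
    · linear_combination (1 / 2 * w * γ * p) * ((B * β - 1) * hA)
    · ring
  · intro u x hu
    rw [Pi.smul_apply, Pi.smul_apply, phase_update_one _ hu, smul_eq_mul, smul_eq_mul]
    ring

lemma equivalent_ruleE2 {G : StabGraph V} {a b : V} (hab : b ∈ G.nbr a) (ha : a ∉ G.loops)
    (hb : b ∉ G.loops) : G.Equivalent (G.ruleE2 a b) := by
  refine equivalent_of_hadamardLayer {a, b} (G.ruleE2_hollow a b) ?_
    (hadamardLayer_mulVec_phase_ruleE2 hab ha hb)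
  unfold nodeWeight
  by_cases hm : a ∈ G.minus <;> by_cases hm' : b ∈ G.minus <;> simp [ha, hb, hm, hm'] <;> norm_num

lemma Step.equivalent {G G' : StabGraph V} (h : G.Step G') : G.Equivalent G' := by
  cases h with
  | e1 v hv => exact equivalent_ruleE1 hv
  | e2 a b hab ha hb => exact equivalent_ruleE2 hab ha hb

lemma equivalent_of_reflTransGen_step {G G' : StabGraph V}
    (h : Relation.ReflTransGen Step G G') : G.Equivalent G' := by
  induction h with
  | refl => exact Equivalent.refl G
  | tail _ h ih => exact ih.trans h.equivalent

end Soundness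

/-! ### Reduced graphs -/

section Reduced

lemma ReducedStep.reflTransGen_step {G G' : StabGraph V} (h : G.ReducedStep G') :
    Relation.ReflTransGen Step G G' := by
  cases h with
  | ei hG h s hh hs hhs hl =>
    rw [ruleEi_eq_ruleE1_ruleE1 hl (hG.1 h hh) hhs]
    refine .tail (.single (.e1 _ s hl)) (.e1 _ h ?_)
    have := hG.1 h hh
    rw [ruleE1_loops]
    exact Or.inr ⟨hhs.symm, this⟩
  | eii hG h s hh hs hhs hl =>
    rw [ruleEii_eq_ruleE2]
    exact .single (.e2 _ h s hhs (hG.1 h hh) hl)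

/-- No hollow node is a neighbor of `h`. So on the other hollow nodes the two local complementations
toggle the same pairs and cancel, while `s` inherits the neighbors of `h`, none of them hollow. -/
lemma IsReduced.ruleEi {G : StabGraph V} (hG : G.IsReduced) {h s : V} (hh : h ∈ G.hollow)
    (hs : s ∉ G.hollow) (hhs : G.edges.Adj h s) : (G.ruleEi h s).IsReduced := by
  have h1 := G.notMem_nbr_self h
  have h2 := G.notMem_nbr_self s
  have h3 := @mem_nbr_comm _ G
  have h4 : s ∈ G.nbr h := hhs
  obtain ⟨hl, he⟩ := hG
  have he' : ∀ a ∈ G.hollow, ∀ b ∈ G.hollow, b ∉ G.nbr a := he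
  have hH : ∀ w, w ∈ (G.ruleEi h s).hollow ↔ w ≠ h ∧ (w ∈ G.hollow ∨ w = s) := by
    intro w
    simp only [ruleEi_hollow, Set.mem_symmDiff, Set.mem_insert_iff, Set.mem_singleton_iff]
    grind
  constructor
  · intro v hv
    rw [hH] at hv
    simp only [ruleEi_loops, Set.mem_symmDiff, Set.mem_sdiff, Set.mem_singleton_iff,
      mem_nbr_localComp]
    grind [Xor]
  · intro a ha b hb
    rw [hH] at ha hb
    rw [ruleEi_edges]
    change b ∉ ((G.localComp s).localComp h).nbr a
    simp only [mem_nbr_localComp]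
    grind [Xor]

/-- Away from `h` and `s`, an edge is toggled only if one of its ends is a neighbor of `h`, hence
solid. -/
lemma IsReduced.ruleEii {G : StabGraph V} (hG : G.IsReduced) {h s : V} (hh : h ∈ G.hollow)
    (hs : s ∉ G.hollow) (hhs : G.edges.Adj h s) (hl : s ∉ G.loops) :
    (G.ruleEii h s).IsReduced := by
  classical
  have h1 := G.notMem_nbr_self h
  have h2 := G.notMem_nbr_self s
  have h3 := @mem_nbr_comm _ G
  have h4 : s ∈ G.nbr h := hhs
  obtain ⟨hl', he⟩ := hG
  have he' : ∀ a ∈ G.hollow, ∀ b ∈ G.hollow, b ∉ G.nbr a := he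
  have hH : ∀ w, w ∈ (G.ruleEii h s).hollow ↔ w ≠ h ∧ (w ∈ G.hollow ∨ w = s) := by
    intro w
    simp only [ruleEii_eq_ruleE2, ruleE2_hollow, Set.mem_symmDiff, Set.mem_insert_iff,
      Set.mem_singleton_iff]
    grind
  constructor
  · intro v hv
    rw [hH] at hv
    rw [ruleEii_eq_ruleE2, ruleE2_loops]
    grind
  · have key : ∀ a ∈ G.hollow, a ≠ h → ∀ b, b ≠ h → (b ∈ G.hollow ∨ b = s) →
        b ∉ (G.localCompEdge h s).nbr a := by
      intro a ha hah b hbh hb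
      have has : a ≠ s := by rintro rfl; exact hs ha
      rw [nbr_localCompEdge_of_ne h4 hah has, if_neg (he' h hh a ha)]
      by_cases hn : a ∈ G.nbr s <;>
        simp only [hn, if_true, if_false, Set.mem_symmDiff, Set.mem_sdiff, Set.mem_insert_iff,
          Set.mem_singleton_iff, Set.mem_empty_iff_false] <;> grind
    have key' : ∀ b ∈ G.hollow, b ≠ h → b ∉ (G.localCompEdge h s).nbr s := by
      intro b hb hbh
      rw [nbr_localCompEdge_right h4]
      simp only [Set.mem_symmDiff, Set.mem_singleton_iff]
      grind
    intro a ha b hb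
    rw [hH] at ha hb
    rw [ruleEii_eq_ruleE2, ruleE2_edges]
    change b ∉ (G.localCompEdge h s).nbr a
    have := (G.localCompEdge h s).notMem_nbr_self s
    grind

lemma ReducedStep.isReduced {G G' : StabGraph V} (h : G.ReducedStep G') : G'.IsReduced := by
  cases h with
  | ei hG h s hh hs hhs hl => exact hG.ruleEi hh hs hhs
  | eii hG h s hh hs hhs hl => exact hG.ruleEii hh hs hhs hl

/-- A hollow node of a reduced graph exchanges its fill with any neighbor. -/
lemma IsReduced.exists_reducedStep {G : StabGraph V} (hG : G.IsReduced) {h s : V}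
    (hh : h ∈ G.hollow) (hhs : G.edges.Adj h s) :
    ∃ G', G.ReducedStep G' ∧ G'.hollow = insert s (G.hollow \ {h}) := by
  have hs : s ∉ G.hollow := fun hs => hG.2 h hh s hs hhs
  have e : G.hollow ∆ {h, s} = insert s (G.hollow \ {h}) := by
    ext w
    have := hhs.ne
    simp only [Set.mem_symmDiff, Set.mem_insert_iff, Set.mem_singleton_iff, Set.mem_sdiff]
    grind
  by_cases hl : s ∈ G.loops
  · exact ⟨_, .ei G hG h s hh hs hhs hl, (G.ruleEi_hollow h s).trans e⟩
  · exact ⟨_, .eii G hG h s hh hs hhs hl, (G.ruleE2_hollow h s).trans e⟩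

/-- Some rule lowers the number of hollow nodes of a graph that is not reduced. -/
lemma exists_step_of_not_isReduced [Finite V] {G : StabGraph V} (hG : ¬ G.IsReduced) :
    ∃ G', G.Step G' ∧ G'.hollow.ncard < G.hollow.ncard := by
  by_cases hl : ∀ v ∈ G.hollow, v ∉ G.loops
  · have : ∃ a ∈ G.hollow, ∃ b ∈ G.hollow, G.edges.Adj a b := by
      by_contra! hcon
      exact hG ⟨hl, hcon⟩
    obtain ⟨a, ha, b, hb, hab⟩ := this
    refine ⟨_, .e2 G a b hab (hl a ha) (hl b hb), Set.ncard_lt_ncard ?_ (Set.toFinite _)⟩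
    rw [ruleE2_hollow, Set.ssubset_iff_of_subset]
    · exact ⟨a, ha, by simp [Set.mem_symmDiff, ha]⟩
    · rintro w (hw | ⟨rfl | rfl, hw⟩)
      exacts [hw.1, ha, hb]
  · push Not at hl
    obtain ⟨v, hv, hl⟩ := hl
    refine ⟨_, .e1 G v hl, Set.ncard_lt_ncard ?_ (Set.toFinite _)⟩
    rw [ruleE1_hollow, Set.ssubset_iff_of_subset]
    · exact ⟨v, hv, by simp [Set.mem_symmDiff, hv]⟩
    · rintro w (hw | ⟨rfl, hw⟩)
      exacts [hw.1, hv]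

/-- Descent on the number of hollow nodes; the bound is kept for the minimality statement. -/
lemma exists_isReduced [Finite V] (G : StabGraph V) :
    ∃ R : StabGraph V, R.IsReduced ∧ Relation.ReflTransGen Step G R ∧
      R.hollow.ncard ≤ G.hollow.ncard := by
  induction hn : G.hollow.ncard using Nat.strong_induction_on generalizing G with
  | _ n ih =>
    by_cases hG : G.IsReduced
    · exact ⟨G, hG, .refl, hn.le⟩
    · obtain ⟨G', hs, hlt⟩ := exists_step_of_not_isReduced hG
      obtain ⟨R, hR, hst, hle⟩ := ih _ (hn ▸ hlt) G' rfl
      exact ⟨R, hR, .head hs hst, by omega⟩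

lemma ReducedStep.ncard_hollow {G G' : StabGraph V} (h : G.ReducedStep G') :
    G'.hollow.ncard = G.hollow.ncard := by
  have key : ∀ a s, a ∈ G.hollow → s ∉ G.hollow →
      (G.hollow ∆ {a, s}).ncard = G.hollow.ncard := by
    intro a s ha hs
    have : G.hollow ∆ {a, s} = insert s (G.hollow \ {a}) := by
      ext w
      simp only [Set.mem_symmDiff, Set.mem_insert_iff, Set.mem_singleton_iff, Set.mem_sdiff]
      grind
    rw [this, Set.ncard_exchange hs ha]
  cases h with
  | ei hG a s ha hs has hl => rw [ruleEi_hollow, key a s ha hs]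
  | eii hG a s ha hs has hl => rw [ruleEii_eq_ruleE2, ruleE2_hollow, key a s ha hs]

lemma ncard_hollow_of_reflTransGen {G G' : StabGraph V}
    (h : Relation.ReflTransGen ReducedStep G G') : G'.hollow.ncard = G.hollow.ncard := by
  induction h with
  | refl => rfl
  | tail _ h ih => rw [h.ncard_hollow, ih]

lemma reflTransGen_step_of_reducedStep {G G' : StabGraph V}
    (h : Relation.ReflTransGen ReducedStep G G') : Relation.ReflTransGen Step G G' := by
  induction h with
  | refl => exact .refl
  | tail _ h ih => exact ih.trans h.reflTransGen_step

end Reduced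

/-! ### Reversibility, exchange of hollow nodes, and completeness -/

section Completeness

variable [Fintype V] [DecidableEq V]

lemma ReducedStep.equivalent {G G' : StabGraph V} (h : G.ReducedStep G') : G.Equivalent G' :=
  equivalent_of_reflTransGen_step h.reflTransGen_step

/-- The rules E1 and E2 are involutions. -/
lemma Step.symm {G G' : StabGraph V} (h : G.Step G') : G'.Step G := by
  cases h with
  | e1 v hv =>
    have hv' : v ∈ (G.ruleE1 v).loops := by
      rw [ruleE1_loops]
      exact Or.inl ⟨hv, G.notMem_nbr_self v⟩
    -- Two uses restore the hollow nodes and preserve the state, so uniqueness replaces a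
    -- combinatorial computation.
    have : (G.ruleE1 v).ruleE1 v = G := by
      refine (((equivalent_ruleE1 hv).trans (equivalent_ruleE1 hv')).eq_of_hollow_eq ?_).symm
      rw [ruleE1_hollow, ruleE1_hollow, symmDiff_assoc, symmDiff_self, symmDiff_bot]
    simpa only [this] using Step.e1 _ v hv'
  | e2 a b hab ha hb =>
    have ha' : a ∉ (G.ruleE2 a b).loops := by rwa [ruleE2_loops]
    have hb' : b ∉ (G.ruleE2 a b).loops := by rwa [ruleE2_loops]
    have hab' : b ∈ (G.ruleE2 a b).nbr a := by
      rw [ruleE2_nbr, nbr_localCompEdge_left hab]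
      have := G.notMem_nbr_self b
      have hne := hab.ne'
      simp [Set.mem_symmDiff, this, hne]
    have : (G.ruleE2 a b).ruleE2 a b = G := by
      refine (((equivalent_ruleE2 hab ha hb).trans
        (equivalent_ruleE2 hab' ha' hb')).eq_of_hollow_eq ?_).symm
      rw [ruleE2_hollow, ruleE2_hollow, symmDiff_assoc, symmDiff_self, symmDiff_bot]
    simpa only [this] using Step.e2 _ a b hab' ha' hb'

/-- Undoing the Hadamards at `z` yields a nonzero phase as a sum over strings agreeing with `z` on
solid nodes, so some term survives. -/
lemma exists_state_ne_zero (G : StabGraph V) (z : V → Fin 2) :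
    ∃ x, (∀ v ∉ G.hollow, x v = z v) ∧ G.state x ≠ 0 := by
  have h := congrFun (hadamardLayer_mulVec_cancel G.hollow G.phase) z
  rw [Matrix.mulVec, dotProduct] at h
  obtain ⟨x, -, hx⟩ := Finset.exists_ne_zero_of_sum_ne_zero (h.trans_ne (G.phase_ne_zero z))
  refine ⟨x, fun v hv => (hadamardLayer_apply_ne_zero (left_ne_zero_of_mul hx) hv).symm, ?_⟩
  rw [state_eq]
  exact mul_ne_zero (inv_sqrt_two_pow_ne_zero _) (right_ne_zero_of_mul hx)

/-- On the support of the state of a reduced graph, the bit of a hollow node is determined by the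
bits of its neighbors. -/
lemma IsReduced.setSign_eq_of_state_ne_zero {G : StabGraph V} (hG : G.IsReduced) {h : V}
    (hh : h ∈ G.hollow) {x : V → Fin 2} (hx : G.state x ≠ 0) :
    setSign {h} x = G.nodeWeight h * setSign (G.nbr h) x := by
  have e : G.hollow = (G.hollow \ {h}) ∆ {h} := by
    ext w
    simp only [Set.mem_symmDiff, Set.mem_singleton_iff, Set.mem_sdiff]
    grind
  rw [state_eq, e, ← hadamardLayer_mul, ← Matrix.mulVec_mulVec] at hx
  obtain ⟨y, -, hy⟩ := Finset.exists_ne_zero_of_sum_ne_zero (right_ne_zero_of_mul hx)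
  have hxy : ∀ v ∉ G.hollow \ {h}, x v = y v := fun v hv =>
    hadamardLayer_apply_ne_zero (left_ne_zero_of_mul hy) hv
  have h1 : setSign {h} y = setSign {h} x := by
    refine setSign_congr fun w => and_congr_right ?_
    rintro rfl
    rw [hxy w (by simp)]
  -- The neighbors of `h` are solid, so the remaining Hadamards leave their bits alone.
  have h2 : setSign (G.nbr h) y = setSign (G.nbr h) x := by
    refine setSign_congr fun w => and_congr_right fun hw => ?_
    rw [hxy w fun h' => hG.2 h hh w h'.1 hw]
  have h3 := right_ne_zero_of_mul hy
  rw [hadamardLayer_singleton_mulVec_phase, h1, h2] at h3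
  have h4 := right_ne_zero_of_mul (right_ne_zero_of_mul h3)
  have hw := nodeWeight_mul_self_of_notMem (hG.1 h hh)
  have ha := setSign_mul_self {h} x
  have hb := setSign_mul_self (G.nbr h) x
  -- All three quantities are `±1`, so one of the factors vanishes; `h4` excludes the second.
  have h5 : (setSign {h} x - G.nodeWeight h * setSign (G.nbr h) x) *
      (1 + G.nodeWeight h * setSign (G.nbr h) x * setSign {h} x) = 0 := by
    generalize setSign {h} x = a at *
    generalize setSign (G.nbr h) x = b at *
    generalize G.nodeWeight h = w at *
    linear_combination w * b * ha - a * b * b * hw - a * hb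
  exact sub_eq_zero.1 ((mul_eq_zero.1 h5).resolve_right h4)

/-- The exchange property of the hollow nodes of equivalent reduced graphs. -/
lemma IsReduced.exists_adj_of_mem_of_notMem {G G' : StabGraph V} (hG : G.IsReduced)
    (h : G.Equivalent G') {a : V} (ha : a ∈ G.hollow) (ha' : a ∉ G'.hollow) :
    ∃ s, G.edges.Adj a s ∧ s ∈ G'.hollow := by
  by_contra! hcon
  obtain ⟨c, hc, h⟩ := h
  have hsupp : ∀ x, G'.state x ≠ 0 → setSign {a} x = G.nodeWeight a * setSign (G.nbr a) x := by
    intro x hx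
    rw [h] at hx
    exact hG.setSign_eq_of_state_ne_zero ha (right_ne_zero_of_mul hx)
  -- Two support strings that differ at `a` but agree on its neighbors, all solid in `G'`,
  -- contradict the parity constraint from `G`.
  obtain ⟨x, hx, hx'⟩ := G'.exists_state_ne_zero 0
  obtain ⟨y, hy, hy'⟩ := G'.exists_state_ne_zero (Function.update 0 a 1)
  have hxa : x a = 0 := hx a ha'
  have hya : y a = 1 := by simpa using hy a ha'
  have hn : setSign (G.nbr a) x = setSign (G.nbr a) y := by
    refine setSign_congr fun w => and_congr_right fun hw => ?_
    have hwa : w ≠ a := by rintro rfl; exact G.notMem_nbr_self _ hw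
    rw [hx w (hcon w hw), hy w (hcon w hw), Function.update_of_ne hwa]
  have := (hsupp x hx').trans ((congrArg _ hn).trans (hsupp y hy').symm)
  simp only [setSign_singleton, hxa, hya] at this
  norm_num at this

lemma IsReduced.reflTransGen_reducedStep {G G' : StabGraph V} (hG : G.IsReduced)
    (hG' : G'.IsReduced) (h : G.Equivalent G') : Relation.ReflTransGen ReducedStep G G' := by
  induction hn : (G.hollow \ G'.hollow).ncard generalizing G with
  | zero =>
    have hsub : G.hollow ⊆ G'.hollow := by
      rwa [Set.ncard_eq_zero (Set.toFinite _), Set.sdiff_eq_empty] at hn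
    have hsub' : G'.hollow ⊆ G.hollow := by
      intro a ha'
      by_contra ha
      obtain ⟨s, has, hs⟩ := hG'.exists_adj_of_mem_of_notMem h.symm ha' ha
      exact hG'.2 a ha' s (hsub hs) has
    rw [h.eq_of_hollow_eq (hsub.antisymm hsub')]
  | succ n ih =>
    have hne : (G.hollow \ G'.hollow).Nonempty := by
      rw [← Set.ncard_pos (Set.toFinite _)]
      omega
    obtain ⟨a, ha, ha'⟩ := hne
    obtain ⟨s, has, hs⟩ := hG.exists_adj_of_mem_of_notMem h ha ha'
    obtain ⟨G₁, hst, hH⟩ := hG.exists_reducedStep ha has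
    refine .head hst (ih hst.isReduced (hst.equivalent.symm.trans h) ?_)
    -- The new hollow node `s` is already hollow in `G'`, so the difference only loses `a`.
    have e : G₁.hollow \ G'.hollow = (G.hollow \ G'.hollow) \ {a} := by
      rw [hH]
      ext w
      simp only [Set.mem_insert_iff, Set.mem_singleton_iff, Set.mem_sdiff]
      grind
    have hmem : a ∈ G.hollow \ G'.hollow := ⟨ha, ha'⟩
    rw [e, Set.ncard_sdiff_singleton_of_mem hmem, hn, Nat.add_sub_cancel]

lemma Equivalent.reflTransGen_step {G G' : StabGraph V} (h : G.Equivalent G') :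
    Relation.ReflTransGen Step G G' := by
  obtain ⟨R, hR, hst, -⟩ := exists_isReduced G
  obtain ⟨R', hR', hst', -⟩ := exists_isReduced G'
  have hRR' : R.Equivalent R' := (equivalent_of_reflTransGen_step hst).symm.trans
    (h.trans (equivalent_of_reflTransGen_step hst'))
  have : Std.Symm (Step (V := V)) := ⟨fun _ _ => Step.symm⟩
  have hback : Relation.ReflTransGen Step R' G' := Relation.ReflTransGen.stdSymm.symm _ _ hst'
  exact (hst.trans (reflTransGen_step_of_reducedStep
    (hR.reflTransGen_reducedStep hR' hRR'))).trans hback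

/-- Exchanges keep the number of hollow nodes, so equivalent reduced graphs have equally many, and
any graph reduces to one with no more than its own. -/
lemma isReduced_iff (G : StabGraph V) : G.IsReduced ↔
    ∀ G' : StabGraph V, G.Equivalent G' → G.hollow.ncard ≤ G'.hollow.ncard := by
  constructor
  · intro hG G' h
    obtain ⟨R, hR, hst, hle⟩ := exists_isReduced G'
    have := ncard_hollow_of_reflTransGen (hG.reflTransGen_reducedStep hR
      (h.trans (equivalent_of_reflTransGen_step hst)))
    omega
  · intro hmin
    by_contra hG
    obtain ⟨G', hst, hlt⟩ := exists_step_of_not_isReduced hG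
    exact absurd (hmin G' hst.equivalent) (not_le.2 hlt)

end Completeness

end StabGraph

theorem mainTheorem1 {V : Type*} [Fintype V] [DecidableEq V] :
    -- E1 and E2 preserve the represented state
    (∀ G G' : StabGraph V, G.Step G' → G.Equivalent G') ∧
    -- E(i) and E(ii) take reduced graphs to equivalent reduced graphs
    (∀ G G' : StabGraph V, G.ReducedStep G' → G'.IsReduced ∧ G.Equivalent G') ∧
    -- graphs represent the same state iff finitely many uses of E1, E2 convert one to the other
    (∀ G G' : StabGraph V,
      G.Equivalent G' ↔ Relation.ReflTransGen StabGraph.Step G G') ∧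
    -- the same for reduced graphs with E(i), E(ii)
    (∀ G G' : StabGraph V, G.IsReduced → G'.IsReduced →
      (G.Equivalent G' ↔ Relation.ReflTransGen StabGraph.ReducedStep G G')) ∧
    -- the reduced graphs of a state are its graphs with the fewest hollow nodes
    (∀ G : StabGraph V,
      G.IsReduced ↔ ∀ G' : StabGraph V, G.Equivalent G' → G.hollow.ncard ≤ G'.hollow.ncard) := by
  refine ⟨fun G G' h => h.equivalent, fun G G' h => ⟨h.isReduced, h.equivalent⟩,
    fun G G' => ⟨fun h => h.reflTransGen_step, StabGraph.equivalent_of_reflTransGen_step⟩,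
    fun G G' hG hG' => ⟨hG.reflTransGen_reducedStep hG', fun h =>
      StabGraph.equivalent_of_reflTransGen_step (StabGraph.reflTransGen_step_of_reducedStep h)⟩,
    StabGraph.isReduced_iff⟩
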